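/- Let $k$ be a field, and give $\mathbb{R}^2$ the product order. An $\mathbb{R}^2$-module is a functor from the poset $\mathbb{R}^2$ to $k$-vector spaces; no finite-dimensionality is assumed. Write $\phi_M(p,q)\colon M_p\to M_q$ for its internal maps, and $p+\varepsilon$ for $p+(\varepsilon,\varepsilon)$. An interval of $\mathbb{R}^2$ is a nonempty subset $I$ that is convex ($p,q\in I$ and $p\le r\le q$ imply $r\in I$) and connected (any two points of $I$ are joined by a finite chain of points of $I$ in which consecutive points are comparable). Its interval module $\mathbb{I}^I$ is $k$ at the points of $I$ and $0$ elsewhere, with identity maps between points $p\le q$ of $I$. A barcode of $M$ is a multiset $B$ of intervals with $M\cong\bigoplus_{I\in B}\mathbb{I}^I$; if it exists it is unique up to a bijection that preserves intervals, and is denoted $B(M)$. A triangle is a nonempty set of the form $\{(x,y)\in\mathbb{R}^2 : x<a,\ y<b\}\setminus\{(x,y) : x+y<0\}$ with $a,b\in\mathbb{R}\cup\{\infty\}$ and $a+b>0$. A module is triangle decomposable if it has a barcode all of whose intervals are triangles. For $\varepsilon\ge 0$, let $M(\varepsilon)$ be the module with $M(\varepsilon)_p=M_{p+\varepsilon}$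 and $\phi_{M(\varepsilon)}(p,q)=\phi_M(p+\varepsilon,q+\varepsilon)$. The modules $M,N$ are $\varepsilon$-interleaved if there are morphisms $f\colon M\to N(\varepsilon)$ and $g\colon N\to M(\varepsilon)$ with $g_{p+\varepsilon}\circ f_p=\phi_M(p,p+2\varepsilon)$ and $f_{p+\varepsilon}\circ g_p=\phi_N(p,p+2\varepsilon)$ for all $p$. They are $\varepsilon$-matched if there is a partial bijection $\sigma$ between $B(M)$ and $B(N)$ such that $\mathbb{I}^I$ and $\mathbb{I}^{\sigma(I)}$ are $\varepsilon$-interleaved for every matched $I$, and every unmatched interval $J$ of $B(M)$ or $B(N)$ is $2\varepsilon$-trivial, i.e. $\phi_{\mathbb{I}^J}(p,p+2\varepsilon)=0$ for all $p$. Let $$d_I(M,N)=\inf\{\varepsilon\ge 0 : M,N \text{ are } \varepsilon\text{-interleaved}\},\qquad d_B(M,N)=\inf\{\varepsilon\ge 0 : M,N \text{ are } \varepsilon\text{-matched}\}$$ in $[0,\infty]$, with $\inf\varnothing=\infty$. **Theorem.** If $M$ and $N$ are triangle decomposable $\mathbb{R}^2$-modules, then $d_B(M,N)=d_I(M,N)$.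 -/

import Mathlib

open CategoryTheory
open scoped NNReal ENNReal DirectSum

noncomputable section

namespace Persistence

universe u v

/-- A `P`-persistence module over `k`: a functor from the poset category `P` to `k`-vector spaces. -/
abbrev PersMod (k : Type u) [Field k] (P : Type v) [PartialOrder P] :=
  P ⥤ ModuleCat.{u} k

/-- An interval of a poset: a nonempty convex subset any two of whose points are joined by a finite
zigzag of comparable points of the subset. -/
structure Interval (P : Type v) [PartialOrder P] where
  carrier : Set P
  nonempty : carrier.Nonempty
  convex : ∀ ⦃p q r : P⦄, p ∈ carrier → q ∈ carrier → p ≤ r → r ≤ q → r ∈ carrier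
  connected : ∀ ⦃p q : P⦄, p ∈ carrier → q ∈ carrier →
    Relation.ReflTransGen (fun a b => a ∈ carrier ∧ b ∈ carrier ∧ (a ≤ b ∨ b ≤ a)) p q

section IntervalModule

open Classical in
/-- The vector space of the interval module of `I` at `p`, as a subspace of `k`:
all of `k` if `p ∈ I`, and `0` otherwise. -/
def intervalFiber (k : Type u) [Field k] {P : Type v} [PartialOrder P] (I : Interval P) (p : P) :
    Submodule k k :=
  if p ∈ I.carrier then ⊤ else ⊥

open Classical in
/-- The internal map of the interval module of `I` from `p` to `q`: it is `c ↦ c` if `q ∈ I`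
(in particular the identity of `k` if both `p` and `q` are in `I`), and `0` otherwise. -/
def intervalMap (k : Type u) [Field k] {P : Type v} [PartialOrder P] (I : Interval P) (p q : P) :
    intervalFiber k I p →ₗ[k] intervalFiber k I q :=
  if h : q ∈ I.carrier then
    (intervalFiber k I p).subtype.codRestrict (intervalFiber k I q)
      (fun _ => by simp [intervalFiber, h])
  else 0

theorem intervalFiber_of_mem {k : Type u} [Field k] {P : Type v} [PartialOrder P]
    {I : Interval P} {p : P} (h : p ∈ I.carrier) : intervalFiber k I p = ⊤ := if_pos h

theorem intervalFiber_of_notMem {k : Type u} [Field k] {P : Type v} [PartialOrder P]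
    {I : Interval P} {p : P} (h : p ∉ I.carrier) : intervalFiber k I p = ⊥ := if_neg h

theorem intervalFiber_coe_eq_zero {k : Type u} [Field k] {P : Type v} [PartialOrder P]
    {I : Interval P} {p : P} (h : p ∉ I.carrier) (c : intervalFiber k I p) : (c : k) = 0 := by
  have hc : ∀ x ∈ intervalFiber k I p, x = 0 := by simp [intervalFiber_of_notMem h]
  exact hc _ c.2

theorem intervalMap_coe_of_mem {k : Type u} [Field k] {P : Type v} [PartialOrder P]
    {I : Interval P} {p q : P} (h : q ∈ I.carrier) (c : intervalFiber k I p) :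
    (intervalMap k I p q c : k) = c := by
  simp only [intervalMap, dif_pos h]
  rfl

theorem intervalMap_coe_of_notMem {k : Type u} [Field k] {P : Type v} [PartialOrder P]
    {I : Interval P} {p q : P} (h : q ∉ I.carrier) (c : intervalFiber k I p) :
    (intervalMap k I p q c : k) = 0 :=
  intervalFiber_coe_eq_zero h _

/-- The interval module of an interval `I`. -/
def intervalModule (k : Type u) [Field k] {P : Type v} [PartialOrder P] (I : Interval P) :
    PersMod k P where
  obj p := ModuleCat.of k (intervalFiber k I p)
  map {p q} _ := ModuleCat.ofHom (intervalMap k I p q)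
  map_id p := by
    ext c
    change (intervalMap k I p p c : k) = c
    by_cases h : p ∈ I.carrier
    · exact intervalMap_coe_of_mem h c
    · rw [intervalFiber_coe_eq_zero h, intervalFiber_coe_eq_zero h]
  map_comp {p q r} f g := by
    ext c
    change (intervalMap k I p r c : k) = intervalMap k I q r (intervalMap k I p q c)
    by_cases hr : r ∈ I.carrier
    · rw [intervalMap_coe_of_mem hr, intervalMap_coe_of_mem hr]
      by_cases hq : q ∈ I.carrier
      · rw [intervalMap_coe_of_mem hq]
      · rw [intervalMap_coe_of_notMem hq]
        exact intervalFiber_coe_eq_zero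
          (fun hp => hq (I.convex hp hr (leOfHom f) (leOfHom g))) c
    · rw [intervalMap_coe_of_notMem hr, intervalMap_coe_of_notMem hr]

end IntervalModule

/-- The direct sum of a family of persistence modules, formed pointwise. -/
def directSumModule {k : Type u} [Field k] {P : Type v} [PartialOrder P] {ι : Type u}
    (M : ι → PersMod k P) : PersMod k P where
  obj p := ModuleCat.of k (⨁ i, (M i).obj p)
  map f := ModuleCat.ofHom (DirectSum.lmap fun i => ((M i).map f).hom)
  map_id p := by
    ext1
    simp only [CategoryTheory.Functor.map_id, ModuleCat.hom_ofHom, ModuleCat.hom_id]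
    exact DirectSum.lmap_id
  map_comp f g := by
    ext1
    simp only [CategoryTheory.Functor.map_comp, ModuleCat.hom_ofHom, ModuleCat.hom_comp]
    exact DirectSum.lmap_comp _ _

/-- The multiset of intervals `B`, given as a family indexed by `ι` so that the copies of an
interval are kept apart, is a barcode of `M`: `M ≅ ⨁ i, 𝕀^(B i)`. -/
def IsBarcode {k : Type u} [Field k] {P : Type v} [PartialOrder P] {ι : Type u}
    (M : PersMod k P) (B : ι → Interval P) : Prop :=
  Nonempty (M ≅ directSumModule fun i => intervalModule k (B i))

/-- The plane `ℝ²` with the product order and coordinatewise addition. (A copy of `ℝ × ℝ`, so that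
its category structure is the poset category rather than a product category.) -/
def Plane : Type := ℝ × ℝ

instance : AddCommGroup Plane := inferInstanceAs (AddCommGroup (ℝ × ℝ))

instance : PartialOrder Plane := inferInstanceAs (PartialOrder (ℝ × ℝ))

instance : IsOrderedAddMonoid Plane := inferInstanceAs (IsOrderedAddMonoid (ℝ × ℝ))

/-- The first coordinate. -/
def Plane.x (p : Plane) : ℝ := Prod.fst p

/-- The second coordinate. -/
def Plane.y (p : Plane) : ℝ := Prod.snd p

/-- The diagonal vector `(ε, ε)` of `ℝ²`. -/
def diag (ε : ℝ≥0) : Plane := ((ε : ℝ), (ε : ℝ))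

theorem le_add_diag (p : Plane) (ε : ℝ≥0) : p ≤ p + diag ε :=
  le_add_of_nonneg_right (show (0 : ℝ × ℝ) ≤ ((ε : ℝ), (ε : ℝ)) from ⟨ε.2, ε.2⟩)

/-- The translation `p ↦ p + (ε, ε)` as an endofunctor of the poset category `ℝ²`
(with the product order). -/
abbrev translation (ε : ℝ≥0) : Plane ⥤ Plane where
  obj p := p + diag ε
  map f := homOfLE (add_le_add_left (leOfHom f) _)

/-- The shifted module `M(ε)`, with `M(ε)_p = M_{p + ε}`. -/
abbrev shift {k : Type u} [Field k] (ε : ℝ≥0) (M : PersMod k Plane) : PersMod k Plane :=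
  translation ε ⋙ M

/-- `M` and `N` are `ε`-interleaved: there are morphisms `f : M ⟶ N(ε)` and `g : N ⟶ M(ε)` such
that `g(ε) ∘ f` and `f(ε) ∘ g` are, at each point `p`, the internal maps from `p` to `p + 2ε`. -/
def Interleaved {k : Type u} [Field k] (ε : ℝ≥0) (M N : PersMod k Plane) : Prop :=
  ∃ (f : M ⟶ shift ε N) (g : N ⟶ shift ε M),
    (∀ p : Plane, f.app p ≫ g.app (p + diag ε) =
      M.map (homOfLE ((le_add_diag p ε).trans (le_add_diag (p + diag ε) ε)))) ∧
    (∀ p : Plane, g.app p ≫ f.app (p + diag ε) =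
      N.map (homOfLE ((le_add_diag p ε).trans (le_add_diag (p + diag ε) ε))))

/-- `M` is `δ`-trivial: every internal map from `p` to `p + δ` vanishes. -/
def IsTrivial {k : Type u} [Field k] (δ : ℝ≥0) (M : PersMod k Plane) : Prop :=
  ∀ p : Plane, M.map (homOfLE (le_add_diag p δ)) = 0

/-- The interleaving distance, in `[0, ∞]`; it is `∞` if there is no interleaving. -/
def interleavingDist {k : Type u} [Field k] (M N : PersMod k Plane) : ℝ≥0∞ :=
  ⨅ (ε : ℝ≥0) (_ : Interleaved ε M N), (ε : ℝ≥0∞)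

/-- The partial bijection `σ` between the multisets of intervals `B` and `C` is an `ε`-matching:
unmatched intervals are `2ε`-trivial and matched intervals are `ε`-interleaved. -/
structure IsMatching (k : Type u) [Field k] {ι κ : Type u} (ε : ℝ≥0)
    (B : ι → Interval Plane) (C : κ → Interval Plane) (σ : ι ≃. κ) : Prop where
  left_trivial : ∀ i, σ i = none → IsTrivial (2 * ε) (intervalModule k (B i))
  right_trivial : ∀ j, σ.symm j = none → IsTrivial (2 * ε) (intervalModule k (C j))
  interleaved : ∀ i j, σ i = some j →
    Interleaved ε (intervalModule k (B i)) (intervalModule k (C j))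

/-- `M` and `N` are `ε`-matched: there is an `ε`-matching between their barcodes. (Barcodes are
unique up to a bijection that preserves the intervals, so it does not matter which are used.) -/
def Matched {k : Type u} [Field k] (ε : ℝ≥0) (M N : PersMod k Plane) : Prop :=
  ∃ (ι κ : Type u) (B : ι → Interval Plane) (C : κ → Interval Plane),
    IsBarcode M B ∧ IsBarcode N C ∧ ∃ σ : ι ≃. κ, IsMatching k ε B C σ

/-- The bottleneck distance of interval decomposable modules, in `[0, ∞]`; it is `∞` if there is
no matching. -/
def bottleneckDist {k : Type u} [Field k] (M N : PersMod k Plane) : ℝ≥0∞ :=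
  ⨅ (ε : ℝ≥0) (_ : Matched ε M N), (ε : ℝ≥0∞)

/-- A triangle: a nonempty set `{(x, y) | x < a, y < b} \ {(x, y) | x + y < 0}` with
`a, b ∈ ℝ ∪ {∞}` and `a + b > 0`. -/
def IsTriangle (T : Set Plane) : Prop :=
  T.Nonempty ∧ ∃ a b : WithTop ℝ, 0 < a + b ∧
    T = {p : Plane | (p.x : WithTop ℝ) < a ∧ (p.y : WithTop ℝ) < b} \
      {p : Plane | p.x + p.y < 0}

/-- `M` is triangle decomposable: it is interval decomposable with a barcode that consists of
triangles. -/
def TriangleDecomposable {k : Type u} [Field k] (M : PersMod k Plane) : Prop :=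
  ∃ (ι : Type u) (B : ι → Interval Plane),
    IsBarcode M B ∧ ∀ i, IsTriangle (B i).carrier

end Persistence

end

/-! A matching of barcodes gives an interleaving summand by summand, for any interval decomposable
modules. The converse is the substance.

A triangle is determined by its corner `(a, b)`, since all triangles share the lower boundary `x + y
= 0`. Write an interleaving of two sums of triangle modules as matrices. Each entry is constant
wherever source and shifted target are both present, so the morphisms become scalar matrices `F` and
`G`. A nonzero scalar forces the target corner to lie at most `ε` beyond the source corner in each
coordinate. For triangles that survive a shift by `2ε`, the interleaving identity says that the
entries of `FG` are Kronecker deltas.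

Order corners by number of infinite coordinates, then by sum of finite coordinates. If `F i j * G j
i'` is nonzero and the key of `i` is at most that of `i'`, then `j` is `ε`-close to `i` or to `i'`
(`close_or_close_of_key_le`). So for a finite set `A` of surviving triangles and a finite set `B`
containing all their close partners, the `A × B` block of `F` has trivial kernel: pair a kernel
vector with the column of `G` at an index of maximal key in its support. This gives `#A ≤ #B`
(`card_le_card_of_coefficients`), Hall's condition.

Barcodes may be infinite and not locally finite, so corners are grouped into the cells of a grid of
mesh `η`. Closeness of cells is locally finite. Infinite families of neighbours are handled by
cardinality, using that rows of `G` have countably many nonzero scalars. The result is an injection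
at cost `ε + 2 * η` in each direction (`exists_injective_of_interleaving`). A Cantor–Bernstein
argument merges the two injections, and `η` tends to `0` in the infimum. -/

noncomputable section

namespace Persistence

universe u v

/-! ### Matchings in infinite bipartite relations -/

section Combinatorics

/-- Two injections along a relation combine into a partial bijection along the relation that covers
both of their domains. -/
theorem exists_pequiv_of_injective {ι κ : Type*} {s : Set ι} {t : Set κ} (R : ι → κ → Prop)
    (f : s → κ) (g : t → ι) (hf : Function.Injective f) (hg : Function.Injective g)
    (hfR : ∀ i : s, R i (f i)) (hgR : ∀ j : t, R (g j) j) :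
    ∃ σ : ι ≃. κ, (∀ i j, σ i = some j → R i j) ∧ (∀ i ∈ s, σ i ≠ none) ∧
      ∀ j ∈ t, σ.symm j ≠ none := by
  classical
  -- Cantor–Bernstein via Knaster–Tarski: on a fixed point `P` the matching follows `f`, and outside
  -- `f '' P` it follows `g` backwards. The fixed point equation makes the two rules compatible and
  -- exhaustive.
  let Φ : Set s →o Set s :=
    ⟨fun P => {i | ∀ j : t, g j = i → ↑j ∈ f '' P}, fun P Q hPQ i hi j hj =>
      Set.image_mono hPQ (hi j hj)⟩
  obtain ⟨P, hP⟩ : ∃ P : Set s, ∀ i, i ∈ P ↔ ∀ j : t, g j = i → ↑j ∈ f '' P :=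
    ⟨OrderHom.lfp Φ, fun i => by
      conv_lhs => rw [← OrderHom.map_lfp Φ]
      rfl⟩
  let Q : ι → κ → Prop := fun i j =>
    (∃ h : i ∈ s, ⟨i, h⟩ ∈ P ∧ f ⟨i, h⟩ = j) ∨ (∃ h : j ∈ t, j ∉ f '' P ∧ g ⟨j, h⟩ = i)
  have hQl : ∀ i j j', Q i j → Q i j' → j = j' := by
    rintro i j j' (⟨h, hi, rfl⟩ | ⟨h, hj, rfl⟩) (⟨h', hi', rfl⟩ | ⟨h', hj', hgi⟩)
    · rfl
    · exact absurd ((hP _).1 hi ⟨j', h'⟩ hgi) hj'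
    · exact absurd ((hP _).1 hi' ⟨j, h⟩ rfl) hj
    · exact congrArg Subtype.val (hg hgi).symm
  have hQr : ∀ i i' j, Q i j → Q i' j → i = i' := by
    rintro i i' j (⟨h, hi, rfl⟩ | ⟨h, hj, rfl⟩) (⟨h', hi', hff⟩ | ⟨h', hj', rfl⟩)
    · exact congrArg Subtype.val (hf hff).symm
    · exact absurd ⟨_, hi, rfl⟩ hj'
    · exact absurd ⟨_, hi', hff⟩ hj
    · rfl
  have key : ∀ i j, (if h : ∃ j, Q i j then some h.choose else none) = some j ↔ Q i j := by
    intro i j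
    constructor
    · intro h
      split_ifs at h with h'
      · rw [← Option.some.inj h]
        exact h'.choose_spec
    · intro h
      rw [dif_pos ⟨j, h⟩]
      exact congrArg some (hQl i _ _ (Exists.choose_spec (⟨j, h⟩ : ∃ j, Q i j)) h)
  have key' : ∀ i j, (if h : ∃ i, Q i j then some h.choose else none) = some i ↔ Q i j := by
    intro i j
    constructor
    · intro h
      split_ifs at h with h'
      · rw [← Option.some.inj h]
        exact h'.choose_spec
    · intro h
      rw [dif_pos ⟨i, h⟩]
      exact congrArg some (hQr _ _ j (Exists.choose_spec (⟨i, h⟩ : ∃ i, Q i j)) h)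
  let σ : ι ≃. κ :=
    { toFun := fun i => if h : ∃ j, Q i j then some h.choose else none
      invFun := fun j => if h : ∃ i, Q i j then some h.choose else none
      inv := fun i j => (key' i j).trans (key i j).symm }
  have hσ : ∀ i j, σ i = some j ↔ Q i j := key
  have hσ' : ∀ i j, σ.symm j = some i ↔ Q i j := key'
  refine ⟨σ, fun i j h => ?_, fun i hi h => ?_, fun j hj h => ?_⟩
  · rcases (hσ i j).1 h with ⟨hi, -, rfl⟩ | ⟨hj, -, rfl⟩
    · exact hfR ⟨i, hi⟩
    · exact hgR ⟨j, hj⟩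
  · by_cases hiP : (⟨i, hi⟩ : s) ∈ P
    · exact Option.some_ne_none _ (((hσ i _).2 (Or.inl ⟨hi, hiP, rfl⟩)).symm.trans h)
    · rw [hP] at hiP
      push Not at hiP
      obtain ⟨j, hj, hjP⟩ := hiP
      exact Option.some_ne_none _ (((hσ i j).2 (Or.inr ⟨j.2, hjP, hj⟩)).symm.trans h)
  · by_cases hjP : j ∈ f '' P
    · obtain ⟨i, hi, rfl⟩ := hjP
      exact Option.some_ne_none _ (((hσ' i _).2 (Or.inl ⟨i.2, hi, rfl⟩)).symm.trans h)
    · exact Option.some_ne_none _ (((hσ' _ j).2 (Or.inr ⟨hj, hjP, rfl⟩)).symm.trans h)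

open Cardinal in
theorem mk_le_of_countable_fibers {α β : Type u} [Infinite β] (φ : α → β)
    (hφ : ∀ b, (φ ⁻¹' {b}).Countable) : #α ≤ #β := by
  have h := mk_le_mk_mul_of_mk_preimage_le φ (fun b => (hφ b).le_aleph0)
  rwa [mul_aleph0_eq (aleph0_le_mk β)] at h

open Cardinal in
theorem mk_le_of_finite_biUnion {α : Type u} {γ : Type*} {S : Set γ} (hS : S.Finite) (A : γ → Set α)
    {c : Cardinal.{u}} (hc : ℵ₀ ≤ c) (h : ∀ s ∈ S, #(A s) ≤ c) : #(⋃ s ∈ S, A s : Set α) ≤ c := by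
  induction S, hS using Set.Finite.induction_on with
  | empty => simp
  | @insert a S _ _ ih =>
    rw [Set.biUnion_insert]
    exact (mk_union_le _ _).trans (add_le_of_le hc (h a (Set.mem_insert _ _))
      (ih fun s hs => h s (Set.mem_insert_of_mem _ hs)))

open Cardinal in
/-- If a finite union of sets has infinite cardinality at least `c`, so has one of the sets. -/
theorem exists_le_mk_of_finite_biUnion {α : Type u} {γ : Type*} {S : Set γ} (hS : S.Finite)
    (A : γ → Set α) {c : Cardinal.{u}} (hinf : (⋃ s ∈ S, A s).Infinite) (hc : c ≤ #(⋃ s ∈ S, A s : Set α)) :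
    ∃ s ∈ S, (A s).Infinite ∧ c ≤ #(A s) := by
  obtain ⟨s₀, hs₀, hmax⟩ : ∃ s ∈ S, ∀ s' ∈ S, #(A s') ≤ #(A s) := by
    have hne : S.Nonempty := by
      rw [Set.nonempty_iff_ne_empty]
      rintro rfl
      simp at hinf
    exact Set.exists_max_image S (fun s => #(A s)) hS hne
  have hs₀inf : (A s₀).Infinite := by
    intro hfin
    refine hinf (hS.biUnion fun s hs => ?_)
    rw [← Cardinal.lt_aleph0_iff_set_finite] at hfin ⊢
    exact (hmax s hs).trans_lt hfin
  refine ⟨s₀, hs₀, hs₀inf, hc.trans (mk_le_of_finite_biUnion hS A ?_ hmax)⟩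
  exact Cardinal.infinite_iff.1 hs₀inf.to_subtype

open Cardinal in
/-- Hall's theorem for a relation that factors through a locally finite relation of classes. The
classes may be infinite, but then their elements need a countable-to-one choice of neighbours. -/
theorem exists_injective_of_locally_finite {ι κ : Type u} {C : Type*}
    (a : ι → C) (b : κ → C) (R : C → C → Prop)
    (hR : ∀ c, {d | R c d}.Finite) (hR' : ∀ d, {c | R c d}.Finite)
    (hfin : ∀ (A : Finset ι) (B : Finset κ),
      (∀ i ∈ A, ∀ j, R (a i) (b j) → j ∈ B) → A.card ≤ B.card)
    (φ : ι → κ) (hφR : ∀ i, R (a i) (b (φ i))) (hφ : ∀ j, (φ ⁻¹' {j}).Countable) :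
    ∃ m : ι → κ, Function.Injective m ∧ ∀ i, R (a i) (b (m i)) := by
  classical
  let S : C → Set κ := fun c => {j | R c (b j)}
  have hS : ∀ c, S c = ⋃ d ∈ {d | R c d}, b ⁻¹' {d} := fun c => by ext j; simp [S]
  -- An infinite neighbourhood is a finite union of fibres of `b`, so one fibre is infinite and
  -- large enough to hold the whole class of `c`; `φ` bounds the size of that class. When `S c` is
  -- finite the chosen value is irrelevant.
  have heavy : ∀ c, ∃ d, (S c).Infinite →
      R c d ∧ (b ⁻¹' {d}).Infinite ∧ #(a ⁻¹' {c}) ≤ #(b ⁻¹' {d}) := by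
    intro c
    by_cases hc : (S c).Infinite
    · have hle : #(a ⁻¹' {c}) ≤ #(S c) := by
        have : Infinite (S c) := hc.to_subtype
        let ψ : a ⁻¹' {c} → S c := fun i => ⟨φ i, by
          have h := hφR i
          rw [show a i = c from i.2] at h
          exact h⟩
        refine mk_le_of_countable_fibers ψ fun j => ?_
        refine Set.Countable.mono ?_ ((hφ j).preimage Subtype.val_injective)
        rintro i hi
        exact congrArg Subtype.val (show ψ i = j from hi)
      rw [hS] at hle hc
      obtain ⟨d, hd, h⟩ := exists_le_mk_of_finite_biUnion (hR c) _ hc hle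
      exact ⟨d, fun _ => ⟨hd, h⟩⟩
    · exact ⟨c, fun h => absurd h hc⟩
  choose d hd using heavy
  -- Only finitely many classes select the same fibre, and a finite union of sets no larger than an
  -- infinite set still embeds in it.
  have emb : ∀ e : C, (b ⁻¹' {e}).Infinite →
      Nonempty ({i | (S (a i)).Infinite ∧ d (a i) = e} ↪ b ⁻¹' {e}) := by
    intro e he
    have hinf : ℵ₀ ≤ #(b ⁻¹' {e}) := Cardinal.infinite_iff.1 he.to_subtype
    have hfinC : {c | (S c).Infinite ∧ d c = e}.Finite :=
      (hR' e).subset (by rintro c ⟨hc, rfl⟩; exact (hd c hc).1)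
    have := mk_le_of_finite_biUnion hfinC (fun c => a ⁻¹' {c}) hinf
      (by rintro c ⟨hc, rfl⟩; exact (hd c hc).2.2)
    refine Cardinal.le_def _ _ |>.1 ((mk_le_mk_of_subset ?_).trans this)
    intro i hi
    simp only [Set.mem_iUnion]
    exact ⟨a i, hi, rfl⟩
  have e : ∀ x : {x : C // (b ⁻¹' {x}).Infinite},
      {i | (S (a i)).Infinite ∧ d (a i) = x} ↪ b ⁻¹' {(x : C)} := fun x => (emb x x.2).some
  let L := {i : ι // ¬ (S (a i)).Infinite}
  have hSL : ∀ i : L, (S (a i)).Finite := fun i => Set.not_infinite.1 i.2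
  -- The remaining elements have finite neighbourhoods, where Hall's marriage theorem applies.
  obtain ⟨m, hm, hmS⟩ := (Finset.all_card_le_biUnion_card_iff_exists_injective
    (fun i : L => (hSL i).toFinset)).1 (by
      intro A
      have := hfin (A.map (Function.Embedding.subtype _))
        (A.biUnion fun i : L => (hSL i).toFinset) (by
          intro i hi j hij
          obtain ⟨i, hiA, rfl⟩ := Finset.mem_map.1 hi
          exact Finset.mem_biUnion.2 ⟨i, hiA, (hSL i).mem_toFinset.2 hij⟩)
      rwa [Finset.card_map] at this)
  have hmR : ∀ i : L, R (a i) (b (m i)) := fun i => (hSL i).mem_toFinset.1 (hmS i)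
  let h : ∀ i, (S (a i)).Infinite → κ := fun i hi => e ⟨d (a i), (hd _ hi).2.1⟩ ⟨i, hi, rfl⟩
  have hb : ∀ i hi, b (h i hi) = d (a i) := fun i hi =>
    (e ⟨d (a i), (hd _ hi).2.1⟩ ⟨i, hi, rfl⟩).2
  have hinj : ∀ i hi i' hi', h i hi = h i' hi' → i = i' := by
    intro i hi i' hi' hh
    have hdd : d (a i') = d (a i) := by rw [← hb i hi, ← hb i' hi', hh]
    have hgen : ∀ (x : C) (hx : d (a i') = x) (hx' : (b ⁻¹' {x}).Infinite),
        h i' hi' = e ⟨x, hx'⟩ ⟨i', hi', hx⟩ := by rintro x rfl hx'; rfl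
    have h1 := hgen _ hdd (hd _ hi).2.1
    rw [h1] at hh
    exact congrArg Subtype.val ((e _).injective (Subtype.ext hh))
  -- The two partial injections cannot collide: a neighbourhood that meets a fibre of `b` contains
  -- all of it, and a finite one contains no infinite fibre.
  have hdisj : ∀ i hi (i' : L), h i hi ≠ m i' := by
    intro i hi i' hh
    refine (hd _ hi).2.1 (Set.Finite.subset (hSL i') ?_)
    intro j hj
    have h1 : b j = b (m i') := by rw [← hh, hb i hi]; exact hj
    show R (a i') (b j)
    rw [h1]
    exact hmR i'
  refine ⟨fun i => if hi : (S (a i)).Infinite then h i hi else m ⟨i, hi⟩, ?_, ?_⟩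
  · intro i i' hii
    by_cases hi : (S (a i)).Infinite <;> by_cases hi' : (S (a i')).Infinite <;>
      simp only [hi, hi', dif_pos, dif_neg, not_false_eq_true] at hii
    · exact hinj i hi i' hi' hii
    · exact absurd hii (hdisj i hi ⟨i', hi'⟩)
    · exact absurd hii.symm (hdisj i' hi' ⟨i, hi⟩)
    · exact congrArg Subtype.val (hm hii)
  · intro i
    by_cases hi : (S (a i)).Infinite
    · simp only [hi, dif_pos]
      rw [hb i hi]
      exact (hd _ hi).1
    · simp only [hi, dif_neg, not_false_eq_true]
      exact hmR ⟨i, hi⟩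

end Combinatorics

/-! ### Closeness of corners, their ordering, and the grid -/

section Corners

/-- Two extended reals are at distance at most `ε`. -/
def Close (ε : ℝ) (a b : WithTop ℝ) : Prop := a ≤ b + (ε : WithTop ℝ) ∧ b ≤ a + (ε : WithTop ℝ)

theorem Close.symm {ε : ℝ} {a b : WithTop ℝ} (h : Close ε a b) : Close ε b a := ⟨h.2, h.1⟩

/-- The ordering key of a corner: the number of infinite coordinates, then the sum of the finite
ones. -/
def cornerKey (a b : WithTop ℝ) : ℕ ×ₗ ℝ :=
  toLex ((if a = ⊤ then 1 else 0) + (if b = ⊤ then 1 else 0), a.untopD 0 + b.untopD 0)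

/-- An infinite coordinate of `(c, d)` forces the same coordinate of `(a', b')`, hence of `(a, b)`,
to be infinite. The first component of the key then makes the infinite coordinates of all three
corners coincide, and these contribute `0` to the sums. If both alternatives failed, adding the
inequalities for the finite coordinates would give a larger sum for `(a, b)` than for `(c, d)`. -/
theorem close_or_close_of_key_le {ε : ℝ} {a b a' b' c d : WithTop ℝ}
    (hkey : cornerKey a b ≤ cornerKey c d)
    (h1 : a' ≤ a + (ε : WithTop ℝ)) (h2 : b' ≤ b + (ε : WithTop ℝ))
    (h3 : c ≤ a' + (ε : WithTop ℝ)) (h4 : d ≤ b' + (ε : WithTop ℝ)) :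
    (Close ε a a' ∧ Close ε b b') ∨ (Close ε c a' ∧ Close ε d b') := by
  rw [cornerKey, cornerKey, Prod.Lex.toLex_le_toLex] at hkey
  by_contra hcon
  simp only [Close, h1, h2, h3, h4, and_true, true_and] at hcon
  rw [not_or] at hcon
  obtain ⟨k1, k2⟩ := hcon
  induction a using WithTop.recTopCoe <;> induction b using WithTop.recTopCoe <;>
  induction c using WithTop.recTopCoe <;> induction d using WithTop.recTopCoe <;>
  induction a' using WithTop.recTopCoe <;> induction b' using WithTop.recTopCoe <;>
  simp only [WithTop.top_add, ← WithTop.coe_add, WithTop.coe_le_coe, le_top,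
    top_le_iff, WithTop.coe_ne_top, and_true, true_and, not_true, not_and_or, not_le,
    if_true, if_false, and_false, WithTop.untopD_coe, WithTop.untopD_top] at * <;>
  norm_num at hkey <;>
  (try (rcases k1 with k1 | k1 <;> rcases k2 with k2 | k2)) <;> linarith

/-- The cell of the grid of mesh `η` that contains a given extended real. -/
def cell (η : ℝ) (a : WithTop ℝ) : WithTop ℤ := a.map fun x => ⌊x / η⌋

/-- Two cells are at most `n` steps apart. -/
def CellClose (n : ℤ) (u v : WithTop ℤ) : Prop :=
  u ≤ v + (n : WithTop ℤ) ∧ v ≤ u + (n : WithTop ℤ)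

theorem CellClose.symm {n : ℤ} {u v : WithTop ℤ} (h : CellClose n u v) : CellClose n v u :=
  ⟨h.2, h.1⟩

theorem finite_cellClose (n : ℤ) (u : WithTop ℤ) : {v | CellClose n u v}.Finite := by
  induction u using WithTop.recTopCoe with
  | top =>
    refine (Set.finite_singleton (⊤ : WithTop ℤ)).subset fun v hv => ?_
    have := hv.1
    induction v using WithTop.recTopCoe with
    | top => rfl
    | coe v => simp [← WithTop.coe_add] at this
  | coe u =>
    refine ((Set.finite_Icc (u - n) (u + n)).image ((↑) : ℤ → WithTop ℤ)).subset fun v hv => ?_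
    obtain ⟨h1, h2⟩ := hv
    induction v using WithTop.recTopCoe with
    | top => simp [← WithTop.coe_add] at h2
    | coe v =>
      simp only [← WithTop.coe_add, WithTop.coe_le_coe] at h1 h2
      exact ⟨v, ⟨by linarith, by linarith⟩, rfl⟩

theorem floor_div_le {η ε x y : ℝ} (hη : 0 < η) (h : x ≤ y + ε) :
    ⌊x / η⌋ ≤ ⌊y / η⌋ + ⌈ε / η⌉ := by
  rw [← Int.floor_add_intCast]
  refine Int.floor_le_floor ?_
  calc x / η ≤ (y + ε) / η := by gcongr
    _ = y / η + ε / η := add_div _ _ _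
    _ ≤ _ := by gcongr; exact Int.le_ceil _

/-- The loss of `2 * η` consists of one mesh from rounding `x / η` down and one from rounding `ε /
η` up. -/
theorem le_of_floor_div_le {η ε x y : ℝ} (hη : 0 < η)
    (h : ⌊x / η⌋ ≤ ⌊y / η⌋ + ⌈ε / η⌉) : x ≤ y + (ε + 2 * η) := by
  have h1 : x / η < ⌊x / η⌋ + 1 := Int.lt_floor_add_one _
  have h2 : (⌊y / η⌋ : ℝ) ≤ y / η := Int.floor_le _
  have h3 : (⌈ε / η⌉ : ℝ) < ε / η + 1 := Int.ceil_lt_add_one _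
  have h4 : (⌊x / η⌋ : ℝ) ≤ ⌊y / η⌋ + ⌈ε / η⌉ := by exact_mod_cast h
  have h5 : x / η ≤ (y + (ε + 2 * η)) / η := by
    have : (y + (ε + 2 * η)) / η = y / η + ε / η + 2 := by field_simp; ring
    linarith
  exact (div_le_div_iff_of_pos_right hη).1 h5

theorem cell_le {η ε : ℝ} (hη : 0 < η) {a b : WithTop ℝ} (h : a ≤ b + (ε : WithTop ℝ)) :
    cell η a ≤ cell η b + ((⌈ε / η⌉ : ℤ) : WithTop ℤ) := by
  induction a using WithTop.recTopCoe <;> induction b using WithTop.recTopCoe <;>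
    simp only [cell, WithTop.map_top, WithTop.map_coe, WithTop.top_add, le_top, ← WithTop.coe_add,
      WithTop.coe_le_coe, top_le_iff, WithTop.coe_ne_top] at *
  exact floor_div_le hη h

theorem le_of_cell_le {η ε : ℝ} (hη : 0 < η) {a b : WithTop ℝ}
    (h : cell η a ≤ cell η b + ((⌈ε / η⌉ : ℤ) : WithTop ℤ)) :
    a ≤ b + ((ε + 2 * η : ℝ) : WithTop ℝ) := by
  induction a using WithTop.recTopCoe <;> induction b using WithTop.recTopCoe <;>
    simp only [cell, WithTop.map_top, WithTop.map_coe, WithTop.top_add, le_top, ← WithTop.coe_add,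
      WithTop.coe_le_coe, top_le_iff, WithTop.coe_ne_top] at *
  exact le_of_floor_div_le hη h

theorem Close.cellClose {η ε : ℝ} (hη : 0 < η) {a b : WithTop ℝ} (h : Close ε a b) :
    CellClose ⌈ε / η⌉ (cell η a) (cell η b) := ⟨cell_le hη h.1, cell_le hη h.2⟩

theorem CellClose.close {η ε : ℝ} (hη : 0 < η) {a b : WithTop ℝ}
    (h : CellClose ⌈ε / η⌉ (cell η a) (cell η b)) : Close (ε + 2 * η) a b :=
  ⟨le_of_cell_le hη h.1, le_of_cell_le hη h.2⟩

theorem exists_rat_between {x ε : ℝ} {a a' : WithTop ℝ} (h : (x : WithTop ℝ) < a)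
    (h' : ((x + ε : ℝ) : WithTop ℝ) < a') :
    ∃ q : ℚ, x < q ∧ ((q : ℝ) : WithTop ℝ) < a ∧ (((q : ℝ) + ε : ℝ) : WithTop ℝ) < a' := by
  induction a using WithTop.recTopCoe with
  | top =>
    induction a' using WithTop.recTopCoe with
    | top =>
      obtain ⟨q, hq⟩ := exists_rat_gt x
      exact ⟨q, hq, WithTop.coe_lt_top _, WithTop.coe_lt_top _⟩
    | coe a' =>
      rw [WithTop.coe_lt_coe] at h'
      obtain ⟨q, hq, hq'⟩ := exists_rat_btwn (lt_sub_iff_add_lt.2 h')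
      exact ⟨q, hq, WithTop.coe_lt_top _, WithTop.coe_lt_coe.2 (lt_sub_iff_add_lt.1 hq')⟩
  | coe a =>
    rw [WithTop.coe_lt_coe] at h
    induction a' using WithTop.recTopCoe with
    | top =>
      obtain ⟨q, hq, hq'⟩ := exists_rat_btwn h
      exact ⟨q, hq, WithTop.coe_lt_coe.2 hq', WithTop.coe_lt_top _⟩
    | coe a' =>
      rw [WithTop.coe_lt_coe] at h'
      obtain ⟨q, hq, hq'⟩ := exists_rat_btwn (lt_min h (lt_sub_iff_add_lt.2 h'))
      exact ⟨q, hq, WithTop.coe_lt_coe.2 (lt_min_iff.1 hq').1,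
        WithTop.coe_lt_coe.2 (lt_sub_iff_add_lt.1 (lt_min_iff.1 hq').2)⟩

theorem lt_of_add_lt_of_le_add {x ε : ℝ} {a b : WithTop ℝ}
    (h : ((x + ε : ℝ) : WithTop ℝ) < b) (hb : b ≤ a + (ε : WithTop ℝ)) :
    (x : WithTop ℝ) < a := by
  induction a using WithTop.recTopCoe with
  | top => exact WithTop.coe_lt_top _
  | coe a =>
    have h1 := h.trans_le hb
    rw [← WithTop.coe_add, WithTop.coe_lt_coe] at h1
    exact WithTop.coe_lt_coe.2 (by linarith)

theorem le_add_of_forall_lt {ε : ℝ} {a b : WithTop ℝ}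
    (h : ∀ x : ℝ, ((x + ε : ℝ) : WithTop ℝ) < b → (x : WithTop ℝ) < a) :
    b ≤ a + (ε : WithTop ℝ) := by
  by_contra hlt
  rw [not_le] at hlt
  induction a using WithTop.recTopCoe with
  | top => simp at hlt
  | coe a => exact lt_irrefl _ (h a (by rwa [WithTop.coe_add]))

end Corners

/-! ### Hall's condition from interleaving matrices -/

section Coefficients

/-- The `A × B` block of `F` defines an injective map from `A → k` to `B → k`. The block of `FG`
itself need not be recoverable from `B`, but the part needed to kill a given kernel vector is. -/
theorem card_le_card_of_coefficients {ι κ : Type*} {k : Type*} [Field k] {ε : ℝ}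
    (a b : ι → WithTop ℝ) (a' b' : κ → WithTop ℝ) (F : ι → κ → k) (G : κ → ι → k)
    (hF : ∀ i j, F i j ≠ 0 → a' j ≤ a i + (ε : WithTop ℝ) ∧ b' j ≤ b i + (ε : WithTop ℝ))
    (hG : ∀ j i, G j i ≠ 0 → a i ≤ a' j + (ε : WithTop ℝ) ∧ b i ≤ b' j + (ε : WithTop ℝ))
    (hsum_self : ∀ i, ∑ᶠ j, F i j * G j i = 1)
    (hsum_ne : ∀ i i', i ≠ i' → ∑ᶠ j, F i j * G j i' = 0)
    (A : Finset ι) (B : Finset κ)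
    (hB : ∀ i ∈ A, ∀ j, Close ε (a i) (a' j) ∧ Close ε (b i) (b' j) → j ∈ B) :
    A.card ≤ B.card := by
  classical
  let Φ : (A → k) →ₗ[k] (B → k) := Matrix.mulVecLin (Matrix.of fun j i => F i j)
  have hΦ : Function.Injective Φ := by
    rw [← LinearMap.ker_eq_bot, LinearMap.ker_eq_bot']
    intro v hv
    by_contra hne
    obtain ⟨i₀, hi₀⟩ := Function.ne_iff.1 hne
    -- Maximality of the key of `m` puts every intermediate `j` between a support index `i` and `m`
    -- close to `i` or to `m`, hence in `B`. The sums over `B` are therefore the full sums.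
    obtain ⟨m, hm, hmax⟩ := Finset.exists_max_image (Finset.univ.filter fun i : A => v i ≠ 0)
      (fun i => cornerKey (a i) (b i)) ⟨i₀, by simpa using hi₀⟩
    have hvm : v m ≠ 0 := (Finset.mem_filter.1 hm).2
    have hT : ∀ i : A, v i ≠ 0 →
        ∑ j : B, F i j * G j m = ∑ᶠ j, F i j * G j m := by
      intro i hi
      have hkey := hmax i (by simpa using hi)
      rw [finsum_eq_sum_of_support_subset (s := B), Finset.sum_coe_sort B fun j => F i j * G j m]
      intro j hj
      have h := hF i j (left_ne_zero_of_mul hj)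
      have h' := hG j m (right_ne_zero_of_mul hj)
      rcases close_or_close_of_key_le hkey h.1 h.2 h'.1 h'.2 with hc | hc
      · exact hB i i.2 j hc
      · exact hB m m.2 j hc
    have hzero : ∑ j : B, Φ v j * G j m = 0 := by simp [hv]
    refine hvm ?_
    calc v m = ∑ i : A, v i * ∑ j : B, F i j * G j m := by
          rw [Finset.sum_eq_single m]
          · rw [hT m hvm, hsum_self, mul_one]
          · intro i _ him
            by_cases hi : v i = 0
            · rw [hi, zero_mul]
            · rw [hT i hi, hsum_ne _ _ (fun h => him (Subtype.ext h)), mul_zero]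
          · simp
      _ = ∑ j : B, Φ v j * G j m := by
          simp only [Φ, Matrix.mulVecLin_apply, Matrix.mulVec, dotProduct, Matrix.of_apply,
            Finset.mul_sum, Finset.sum_mul]
          rw [Finset.sum_comm]
          refine Finset.sum_congr rfl fun j _ => Finset.sum_congr rfl fun i _ => ?_
          ring
      _ = 0 := hzero
  simpa using LinearMap.finrank_le_finrank_of_injective hΦ

/-- If the families of corners admit `ε`-interleaving coefficients, then the first one injects into
the second one along pairs of nearby corners. -/
theorem exists_injective_of_coefficients {ι κ : Type u} {k : Type*} [Field k] {ε η : ℝ}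
    (hη : 0 < η)
    (a b : ι → WithTop ℝ) (a' b' : κ → WithTop ℝ) (F : ι → κ → k) (G : κ → ι → k)
    (hF : ∀ i j, F i j ≠ 0 → a' j ≤ a i + (ε : WithTop ℝ) ∧ b' j ≤ b i + (ε : WithTop ℝ))
    (hG : ∀ j i, G j i ≠ 0 → a i ≤ a' j + (ε : WithTop ℝ) ∧ b i ≤ b' j + (ε : WithTop ℝ))
    (hGc : ∀ j, {i | G j i ≠ 0}.Countable)
    (hsum_self : ∀ i, ∑ᶠ j, F i j * G j i = 1)
    (hsum_ne : ∀ i i', i ≠ i' → ∑ᶠ j, F i j * G j i' = 0) :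
    ∃ m : ι → κ, Function.Injective m ∧
      ∀ i, Close (ε + 2 * η) (a i) (a' (m i)) ∧ Close (ε + 2 * η) (b i) (b' (m i)) := by
  -- A nonzero term of the diagonal sum provides the close partner; it is countable-to-one because
  -- `G j` has countable support.
  have hφ : ∀ i, ∃ j, F i j * G j i ≠ 0 := by
    intro i
    by_contra! h
    have := hsum_self i
    simp [h] at this
  choose φ hφ using hφ
  let n : ℤ := ⌈ε / η⌉
  let R : WithTop ℤ × WithTop ℤ → WithTop ℤ × WithTop ℤ → Prop :=
    fun u v => CellClose n u.1 v.1 ∧ CellClose n u.2 v.2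
  have hR : ∀ u, {v | R u v}.Finite := fun u =>
    (finite_cellClose n u.1).prod (finite_cellClose n u.2)
  have hR' : ∀ u, {v | R v u}.Finite := fun u =>
    (hR u).subset fun v hv => ⟨hv.1.symm, hv.2.symm⟩
  have hclose : ∀ i j, Close ε (a i) (a' j) ∧ Close ε (b i) (b' j) →
      R (cell η (a i), cell η (b i)) (cell η (a' j), cell η (b' j)) := fun i j h =>
    ⟨h.1.cellClose hη, h.2.cellClose hη⟩
  obtain ⟨m, hm, hmR⟩ := exists_injective_of_locally_finite
    (fun i => (cell η (a i), cell η (b i))) (fun j => (cell η (a' j), cell η (b' j))) R hR hR'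
    (fun A B hAB => card_le_card_of_coefficients a b a' b' F G hF hG hsum_self hsum_ne A B
      fun i hi j hij => hAB i hi j (hclose i j hij)) φ
    (fun i => hclose i _ (by
      have h := hF _ _ (left_ne_zero_of_mul (hφ i))
      have h' := hG _ _ (right_ne_zero_of_mul (hφ i))
      exact ⟨⟨h'.1, h.1⟩, ⟨h'.2, h.2⟩⟩))
    (fun j => (hGc j).mono fun i hi => by
      obtain rfl : φ i = j := hi
      exact right_ne_zero_of_mul (hφ i))
  exact ⟨m, hm, fun i => ⟨(hmR i).1.close hη, (hmR i).2.close hη⟩⟩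

end Coefficients

/-! ### Morphisms out of direct sums of persistence modules -/

section DirectSums

variable {k : Type u} [Field k] {P : Type v} [PartialOrder P] {ι : Type u}

/-- The inclusion of a summand. -/
def directSumIncl (M : ι → PersMod k P) (i : ι) : M i ⟶ directSumModule M where
  app p := ModuleCat.ofHom (by
    classical exact DirectSum.lof k ι (fun i => (M i).obj p) i)
  naturality p q f := by
    classical
    ext x
    exact (DirectSum.lmap_lof (fun i => ((M i).map f).hom) i x).symm

/-- The morphism out of a direct sum with given components. -/
def directSumDesc (M : ι → PersMod k P) {X : PersMod k P} (φ : ∀ i, M i ⟶ X) :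
    directSumModule M ⟶ X where
  app p := ModuleCat.ofHom (by
    classical exact DirectSum.toModule k ι (X.obj p) fun i => ((φ i).app p).hom)
  naturality p q f := by
    classical
    ext1
    refine DirectSum.linearMap_ext k fun i => ?_
    ext x
    change DirectSum.toModule k ι (X.obj q) (fun i => ((φ i).app q).hom)
        (DirectSum.lmap (fun i => ((M i).map f).hom) (DirectSum.lof k ι _ i x)) =
      (X.map f).hom (DirectSum.toModule k ι (X.obj p) (fun i => ((φ i).app p).hom)
        (DirectSum.lof k ι _ i x))
    rw [DirectSum.lmap_lof, DirectSum.toModule_lof, DirectSum.toModule_lof]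
    exact congrArg (fun h => h.hom x) ((φ i).naturality f)

theorem directSumIncl_desc_app (M : ι → PersMod k P) {X : PersMod k P} (φ : ∀ i, M i ⟶ X)
    (i : ι) (p : P) :
    (directSumIncl M i).app p ≫ (directSumDesc M φ).app p = (φ i).app p := by
  classical
  ext x
  exact DirectSum.toModule_lof (M := fun i => (M i).obj p) (φ := fun i => ((φ i).app p).hom) k i x

theorem directSum_obj_hom_ext (M : ι → PersMod k P) {p : P} {X : ModuleCat.{u} k}
    {f g : (directSumModule M).obj p ⟶ X}
    (h : ∀ i, (directSumIncl M i).app p ≫ f = (directSumIncl M i).app p ≫ g) : f = g := by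
  classical
  ext1
  refine DirectSum.linearMap_ext k fun i => ?_
  exact congrArg ModuleCat.Hom.hom (h i)

end DirectSums

/-! ### Matchings induce interleavings -/

section Interleavings

variable {k : Type u} [Field k]

theorem Interleaved.of_iso {ε : ℝ≥0} {M N M' N' : PersMod k Plane} (h : Interleaved ε M N)
    (e : M ≅ M') (e' : N ≅ N') : Interleaved ε M' N' := by
  obtain ⟨f, g, h₁, h₂⟩ := h
  refine ⟨e.inv ≫ f ≫ Functor.whiskerLeft (translation ε) e'.hom,
    e'.inv ≫ g ≫ Functor.whiskerLeft (translation ε) e.hom, fun p => ?_, fun p => ?_⟩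
  · have := e.hom.naturality
      (homOfLE ((le_add_diag p ε).trans (le_add_diag (p + diag ε) ε)))
    simp only [NatTrans.comp_app, Functor.whiskerLeft_app, Category.assoc,
      Iso.hom_inv_id_app_assoc]
    rw [reassoc_of% h₁ p, this, Iso.inv_hom_id_app_assoc]
  · have := e'.hom.naturality
      (homOfLE ((le_add_diag p ε).trans (le_add_diag (p + diag ε) ε)))
    simp only [NatTrans.comp_app, Functor.whiskerLeft_app, Category.assoc,
      Iso.hom_inv_id_app_assoc]
    rw [reassoc_of% h₂ p, this, Iso.inv_hom_id_app_assoc]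

theorem add_diag_add_diag (p : Plane) (ε : ℝ≥0) : p + diag ε + diag ε = p + diag (2 * ε) := by
  have h : diag ε + diag ε = diag (2 * ε) := by
    refine Prod.ext ?_ ?_ <;>
    · change (ε : ℝ) + ε = ((2 * ε : ℝ≥0) : ℝ)
      push_cast
      ring
  rw [add_assoc, h]

theorem IsTrivial.map_eq_zero {ε : ℝ≥0} {M : PersMod k Plane} (h : IsTrivial (2 * ε) M)
    (p : Plane) (hp : p ≤ p + diag ε + diag ε) : M.map (homOfLE hp) = 0 := by
  -- The two endpoints are equal but not definitionally so; a variable endpoint lets the equality be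
  -- substituted.
  have key : ∀ q (hq : p ≤ q), q = p + diag (2 * ε) → M.map (homOfLE hq) = 0 := by
    rintro q hq rfl
    exact h p
  exact key _ hp (add_diag_add_diag p ε)

/-- The component at `i` of the morphism between direct sums given by a partial matching. -/
def matchingComponent {ι κ : Type u} {ε : ℝ≥0} (M : ι → PersMod k Plane) (N : κ → PersMod k Plane)
    (σ : ι → Option κ) (f : ∀ i j, σ i = some j → (M i ⟶ shift ε (N j))) (i : ι) :
    M i ⟶ shift ε (directSumModule N) :=
  match h : σ i with
  | none => 0
  | some j => f i j h ≫ Functor.whiskerLeft (translation ε) (directSumIncl N j)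

theorem matchingComponent_of_some {ι κ : Type u} {ε : ℝ≥0} (M : ι → PersMod k Plane)
    (N : κ → PersMod k Plane) (σ : ι → Option κ)
    (f : ∀ i j, σ i = some j → (M i ⟶ shift ε (N j))) {i : ι} {j : κ} (h : σ i = some j) :
    matchingComponent M N σ f i =
      f i j h ≫ Functor.whiskerLeft (translation ε) (directSumIncl N j) := by
  rw [matchingComponent]
  split
  · simp_all
  · next j' h' =>
    obtain rfl : j' = j := Option.some.inj (h'.symm.trans h)
    rfl

/-- It suffices to compare on each summand. On a matched one the composite is that of the given
pair; on an unmatched one both sides vanish, the right side by triviality. -/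
theorem directSum_matching_comp {ι κ : Type u} {ε : ℝ≥0} (M : ι → PersMod k Plane)
    (N : κ → PersMod k Plane) (σ : ι ≃. κ)
    (f : ∀ i j, σ i = some j → (M i ⟶ shift ε (N j)))
    (g : ∀ j i, σ.symm j = some i → (N j ⟶ shift ε (M i)))
    (hfg : ∀ i j (h : σ i = some j) (h' : σ.symm j = some i) (p : Plane),
      (f i j h).app p ≫ (g j i h').app (p + diag ε) =
      (M i).map (homOfLE ((le_add_diag p ε).trans (le_add_diag (p + diag ε) ε))))
    (htriv : ∀ i, σ i = none → IsTrivial (2 * ε) (M i)) (p : Plane) :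
    (directSumDesc M (matchingComponent M N σ f)).app p ≫
      (directSumDesc N (matchingComponent N M σ.symm g)).app (p + diag ε) =
    (directSumModule M).map
      (homOfLE ((le_add_diag p ε).trans (le_add_diag (p + diag ε) ε))) := by
  refine directSum_obj_hom_ext M fun i => ?_
  rw [← (directSumIncl M i).naturality, ← Category.assoc, directSumIncl_desc_app]
  rcases h : σ i with _ | j
  · rw [(htriv i h).map_eq_zero, Limits.zero_comp]
    have : matchingComponent M N σ f i = 0 := by
      rw [matchingComponent]
      split
      · rfl
      · simp_all
    rw [this]
    exact Limits.zero_comp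
  · have h' : σ.symm j = some i := (PEquiv.mem_iff_mem σ).2 h
    rw [matchingComponent_of_some M N σ f h, ← hfg i j h h' p]
    simp only [NatTrans.comp_app, Functor.whiskerLeft_app, Category.assoc]
    have := directSumIncl_desc_app N (matchingComponent N M σ.symm g) j (p + diag ε)
    erw [this]
    rw [matchingComponent_of_some N M σ.symm g h']
    rfl

theorem Matched.interleaved {ε : ℝ≥0} {M N : PersMod k Plane} (h : Matched ε M N) :
    Interleaved ε M N := by
  obtain ⟨ι, κ, B, C, ⟨e⟩, ⟨e'⟩, σ, hσ⟩ := h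
  refine Interleaved.of_iso ?_ e.symm e'.symm
  choose f g hfg hgf using hσ.interleaved
  have hs : ∀ j i, σ.symm j = some i → σ i = some j := fun j i h => (PEquiv.mem_iff_mem σ).1 h
  refine ⟨directSumDesc _ (matchingComponent _ _ σ f),
    directSumDesc _ (matchingComponent _ _ σ.symm fun j i h => g i j (hs j i h)), ?_, ?_⟩
  · exact directSum_matching_comp _ _ σ f _ (fun i j h _ => hfg i j h) hσ.left_trivial
  · exact directSum_matching_comp _ _ σ.symm (fun j i h => g i j (hs j i h)) f
      (fun j i h _ => hgf i j (hs j i h)) hσ.right_trivial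

end Interleavings

/-! ### Interleavings between triangle modules -/

section Triangles

/-- The point of the plane with given coordinates. -/
def Plane.mk (x y : ℝ) : Plane := (x, y)

/-- `I` is the triangle with upper right corner `(a, b)`. -/
def HasCorner (I : Interval Plane) (a b : WithTop ℝ) : Prop :=
  ∀ p : Plane, p ∈ I.carrier ↔ (p.x : WithTop ℝ) < a ∧ (p.y : WithTop ℝ) < b ∧ 0 ≤ p.x + p.y

theorem IsTriangle.hasCorner {I : Interval Plane} (h : IsTriangle I.carrier) :
    ∃ a b, HasCorner I a b := by
  obtain ⟨-, a, b, -, h⟩ := h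
  refine ⟨a, b, fun p => ?_⟩
  rw [h]
  simp [and_assoc]

variable {k : Type u} [Field k]

/-- The component at `p` of a morphism between interval modules, as a linear map of fibers. -/
abbrev fiberMap {ε : ℝ≥0} {I J : Interval Plane}
    (f : intervalModule k I ⟶ shift ε (intervalModule k J)) (p : Plane) :
    intervalFiber k I p →ₗ[k] intervalFiber k J (p + diag ε) := (f.app p).hom

/-- Only naturality is at stake. For `p ≤ q` with `p` in `I` and `q + ε` in `J`, the corner bounds
put `q` in `I`, and the common lower boundary puts `p + ε` in `J`, so all the maps involved are
identities. -/
theorem intervalModule_interleaving {ε : ℝ≥0} {I J : Interval Plane} {a b a' b' : WithTop ℝ}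
    (hI : HasCorner I a b) (hJ : HasCorner J a' b')
    (ha : a' ≤ a + ((ε : ℝ) : WithTop ℝ)) (hb : b' ≤ b + ((ε : ℝ) : WithTop ℝ)) :
    ∃ f : intervalModule k I ⟶ shift ε (intervalModule k J),
      ∀ (p : Plane) (c : intervalFiber k I p), p + diag ε ∈ J.carrier →
        (fiberMap f p c : k) = c := by
  classical
  let φ : ∀ p : Plane, intervalFiber k I p →ₗ[k] intervalFiber k J (p + diag ε) := fun p =>
    if h : p + diag ε ∈ J.carrier then
      (intervalFiber k I p).subtype.codRestrict (intervalFiber k J (p + diag ε))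
        (fun _ => by simp [intervalFiber_of_mem h])
    else 0
  have hφ : ∀ (p : Plane) (c : intervalFiber k I p), p + diag ε ∈ J.carrier →
      (φ p c : k) = c := by
    intro p c hp
    simp only [φ, dif_pos hp]
    rfl
  refine ⟨⟨fun p => ModuleCat.ofHom (φ p), fun p q f => ?_⟩, hφ⟩
  have hpq : p ≤ q := leOfHom f
  ext c
  revert c
  change ∀ c : intervalFiber k I p,
    φ q (intervalMap k I p q c) = intervalMap k J (p + diag ε) (q + diag ε) (φ p c)
  intro c
  refine Subtype.ext ?_
  by_cases hq : q + diag ε ∈ J.carrier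
  · rw [hφ _ _ hq, intervalMap_coe_of_mem hq]
    by_cases hp : p ∈ I.carrier
    · obtain ⟨hp1, hp2, hp3⟩ := (hI p).1 hp
      obtain ⟨hq1, hq2, hq3⟩ := (hJ _).1 hq
      have hx : p.x ≤ q.x := hpq.1
      have hy : p.y ≤ q.y := hpq.2
      have hqI : q ∈ I.carrier := (hI q).2
        ⟨lt_of_add_lt_of_le_add hq1 ha, lt_of_add_lt_of_le_add hq2 hb, by linarith⟩
      have hpJ : p + diag ε ∈ J.carrier := by
        refine (hJ _).2 ⟨lt_of_le_of_lt (WithTop.coe_le_coe.2 ?_) hq1,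
          lt_of_le_of_lt (WithTop.coe_le_coe.2 ?_) hq2, ?_⟩
        · exact add_le_add_left hx _
        · exact add_le_add_left hy _
        · change 0 ≤ (p.x + ε) + (p.y + ε)
          have := ε.2
          linarith
      rw [intervalMap_coe_of_mem hqI, hφ _ _ hpJ]
    · have hc : c = 0 := Subtype.ext (intervalFiber_coe_eq_zero hp c)
      simp [hc]
  · rw [intervalFiber_coe_eq_zero hq, intervalFiber_coe_eq_zero hq]

/-- If `p` and `p + 2ε` lie in `I`, the corner bounds put the midpoint `p + ε` in `J`, so nothing is
lost on the way. -/
theorem intervalModule_interleaving_comp {ε : ℝ≥0} {I J : Interval Plane} {a b a' b' : WithTop ℝ}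
    (hI : HasCorner I a b) (hJ : HasCorner J a' b')
    (ha : a ≤ a' + ((ε : ℝ) : WithTop ℝ)) (hb : b ≤ b' + ((ε : ℝ) : WithTop ℝ))
    (f : intervalModule k I ⟶ shift ε (intervalModule k J))
    (hf : ∀ (p : Plane) (c : intervalFiber k I p), p + diag ε ∈ J.carrier →
        (fiberMap f p c : k) = c)
    (g : intervalModule k J ⟶ shift ε (intervalModule k I))
    (hg : ∀ (p : Plane) (c : intervalFiber k J p), p + diag ε ∈ I.carrier →
        (fiberMap g p c : k) = c) (p : Plane) :
    f.app p ≫ g.app (p + diag ε) = (intervalModule k I).map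
      (homOfLE ((le_add_diag p ε).trans (le_add_diag (p + diag ε) ε))) := by
  ext c
  revert c
  change ∀ c : intervalFiber k I p,
    fiberMap g (p + diag ε) (fiberMap f p c) = intervalMap k I p (p + diag ε + diag ε) c
  intro c
  refine Subtype.ext ?_
  by_cases hq : p + diag ε + diag ε ∈ I.carrier
  · rw [intervalMap_coe_of_mem hq]
    refine (hg _ _ hq).trans ?_
    by_cases hp : p ∈ I.carrier
    · obtain ⟨hp1, hp2, hp3⟩ := (hI p).1 hp
      obtain ⟨hq1, hq2, hq3⟩ := (hI _).1 hq
      refine hf _ _ ((hJ _).2 ⟨lt_of_add_lt_of_le_add hq1 ha, lt_of_add_lt_of_le_add hq2 hb, ?_⟩)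
      change 0 ≤ (p.x + ε) + (p.y + ε)
      have := ε.2
      linarith
    · have hc : c = 0 := Subtype.ext (intervalFiber_coe_eq_zero hp c)
      subst hc
      rw [map_zero]
      rfl
  · rw [intervalFiber_coe_eq_zero hq, intervalFiber_coe_eq_zero hq]

theorem interleaved_of_close {ε : ℝ≥0} {I J : Interval Plane} {a b a' b' : WithTop ℝ}
    (hI : HasCorner I a b) (hJ : HasCorner J a' b') (ha : Close ε a a') (hb : Close ε b b') :
    Interleaved ε (intervalModule k I) (intervalModule k J) := by
  obtain ⟨f, hf⟩ := intervalModule_interleaving (k := k) hI hJ ha.2 hb.2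
  obtain ⟨g, hg⟩ := intervalModule_interleaving (k := k) hJ hI ha.1 hb.1
  exact ⟨f, g, intervalModule_interleaving_comp hI hJ ha.1 hb.1 f hf g hg,
    intervalModule_interleaving_comp hJ hI ha.2 hb.2 g hg f hf⟩

theorem exists_mem_of_not_isTrivial {δ : ℝ≥0} {I : Interval Plane}
    (h : ¬ IsTrivial δ (intervalModule k I)) : ∃ p, p ∈ I.carrier ∧ p + diag δ ∈ I.carrier := by
  contrapose! h
  intro p
  ext c
  revert c
  change ∀ c : intervalFiber k I p,
    intervalMap k I p (p + diag δ) c = 0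
  intro c
  refine Subtype.ext ?_
  by_cases hp : p ∈ I.carrier
  · exact intervalMap_coe_of_notMem (h p hp) c
  · have hc : c = 0 := Subtype.ext (intervalFiber_coe_eq_zero hp c)
    simp [hc]

end Triangles

/-! ### Scalar matrices of morphisms between sums of triangle modules -/

section Entries

variable {k : Type u} [Field k] {ι κ : Type u}

open Classical in
/-- The generator of an interval module at a point of the interval; it is `0` elsewhere. -/
def intervalGen (k : Type u) [Field k] (I : Interval Plane) (p : Plane) : intervalFiber k I p :=
  ⟨if p ∈ I.carrier then 1 else 0, by
    by_cases h : p ∈ I.carrier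
    · rw [intervalFiber_of_mem h]
      trivial
    · rw [if_neg h]
      exact zero_mem _⟩

theorem intervalGen_coe_of_mem {I : Interval Plane} {p : Plane} (h : p ∈ I.carrier) :
    (intervalGen k I p : k) = 1 := if_pos h

theorem intervalGen_of_notMem {I : Interval Plane} {p : Plane} (h : p ∉ I.carrier) :
    intervalGen k I p = 0 := Subtype.ext (intervalFiber_coe_eq_zero h _)

theorem smul_intervalGen {I : Interval Plane} {p : Plane} (c : intervalFiber k I p) :
    (c : k) • intervalGen k I p = c := by
  refine Subtype.ext ?_
  by_cases h : p ∈ I.carrier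
  · simp [intervalGen_coe_of_mem h]
  · rw [intervalFiber_coe_eq_zero h, intervalFiber_coe_eq_zero h]

theorem intervalMap_intervalGen {I : Interval Plane} {p q : Plane} (hp : p ∈ I.carrier) :
    intervalMap k I p q (intervalGen k I p) = intervalGen k I q := by
  refine Subtype.ext ?_
  by_cases h : q ∈ I.carrier
  · rw [intervalMap_coe_of_mem h, intervalGen_coe_of_mem h, intervalGen_coe_of_mem hp]
  · rw [intervalFiber_coe_eq_zero h, intervalFiber_coe_eq_zero h]

/-- The direct sum of the interval modules of a family of intervals. -/
abbrev barcodeModule (k : Type u) [Field k] (B : ι → Interval Plane) : PersMod k Plane :=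
  directSumModule fun i => intervalModule k (B i)

open Classical in
/-- The generator of the `i`-th summand at `p`. -/
def barcodeGen (k : Type u) [Field k] (B : ι → Interval Plane) (i : ι) (p : Plane) :
    ⨁ i, intervalFiber k (B i) p :=
  DirectSum.lof k ι (fun i => intervalFiber k (B i) p) i (intervalGen k (B i) p)

theorem linearMap_apply_eq_finsum {B : ι → Interval Plane} {p : Plane} {V : Type*}
    [AddCommGroup V] [Module k V] (h : (⨁ i, intervalFiber k (B i) p) →ₗ[k] V)
    (v : ⨁ i, intervalFiber k (B i) p) :
    h v = ∑ᶠ i, (v i : k) • h (barcodeGen k B i p) := by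
  classical
  rw [finsum_eq_sum_of_support_subset (s := DFinsupp.support v)]
  · conv_lhs => rw [← DirectSum.sum_support_of v, map_sum]
    refine Finset.sum_congr rfl fun i _ => ?_
    conv_lhs => rw [← smul_intervalGen (v i)]
    rw [← map_smul, barcodeGen, ← map_smul]
    rfl
  · intro i hi
    by_contra hv
    refine hi ?_
    have : v i = 0 := by simpa using hv
    simp [this]

/-- The image of a generator under a morphism. -/
def genImage {ε : ℝ≥0} {B : ι → Interval Plane} {C : κ → Interval Plane}
    (f : barcodeModule k B ⟶ shift ε (barcodeModule k C)) (i : ι) (p : Plane) :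
    ⨁ j, intervalFiber k (C j) (p + diag ε) :=
  (f.app p).hom (barcodeGen k B i p)

/-- The matrix entry of a morphism at a point. -/
def entry {ε : ℝ≥0} {B : ι → Interval Plane} {C : κ → Interval Plane}
    (f : barcodeModule k B ⟶ shift ε (barcodeModule k C)) (i : ι) (j : κ) (p : Plane) : k :=
  (genImage f i p j : k)

variable {ε : ℝ≥0} {B : ι → Interval Plane} {C : κ → Interval Plane}
  (f : barcodeModule k B ⟶ shift ε (barcodeModule k C))

theorem entry_of_notMem {i : ι} {p : Plane} (hp : p ∉ (B i).carrier) (j : κ) :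
    entry f i j p = 0 := by
  have : barcodeGen k B i p = 0 := by
    rw [barcodeGen, intervalGen_of_notMem hp, map_zero]
  have h : genImage f i p = 0 := (congrArg (f.app p).hom this).trans (map_zero _)
  rw [entry, h]
  rfl

theorem entry_of_notMem_right (i : ι) {j : κ} {p : Plane} (hp : p + diag ε ∉ (C j).carrier) :
    entry f i j p = 0 := intervalFiber_coe_eq_zero hp _

theorem finite_entry_ne_zero (i : ι) (p : Plane) : {j | entry f i j p ≠ 0}.Finite := by
  classical
  refine (DFinsupp.support (genImage f i p)).finite_toSet.subset fun j hj => ?_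
  rw [Finset.mem_coe, DFinsupp.mem_support_iff]
  intro h
  exact hj (congrArg Subtype.val h)

theorem barcodeModule_map_gen {p q : Plane} (hpq : p ≤ q) {i : ι} (hp : p ∈ (B i).carrier) :
    ((barcodeModule k B).map (homOfLE hpq)).hom (barcodeGen k B i p) = barcodeGen k B i q := by
  classical
  refine (DirectSum.lmap_lof (fun i => intervalMap k (B i) p q) i _).trans ?_
  rw [intervalMap_intervalGen hp]
  rfl

/-- This is naturality in the `j`-th coordinate. Neither `q ∈ B i` nor `p + ε ∈ C j` is required, so
the equality also forces entries to vanish. -/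
theorem entry_eq_of_le {i : ι} {j : κ} {p q : Plane} (hpq : p ≤ q) (hp : p ∈ (B i).carrier)
    (hq : q + diag ε ∈ (C j).carrier) : entry f i j p = entry f i j q := by
  have h := congrArg (fun φ => φ.hom (barcodeGen k B i p)) (f.naturality (homOfLE hpq))
  have h1 : (f.app q).hom (((barcodeModule k B).map (homOfLE hpq)).hom (barcodeGen k B i p)) =
      DirectSum.lmap (fun j => intervalMap k (C j) (p + diag ε) (q + diag ε))
        (genImage f i p) := h
  rw [barcodeModule_map_gen hpq hp] at h1
  rw [entry, entry, genImage.eq_1 f i q, h1, DirectSum.lmap_apply, intervalMap_coe_of_mem hq]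

theorem finsum_entry_mul_entry (g : barcodeModule k C ⟶ shift ε (barcodeModule k B))
    (hfg : ∀ p : Plane, f.app p ≫ g.app (p + diag ε) = (barcodeModule k B).map
      (homOfLE ((le_add_diag p ε).trans (le_add_diag (p + diag ε) ε))))
    {i : ι} {p : Plane} (hp : p ∈ (B i).carrier) (i' : ι) :
    ∑ᶠ j, entry f i j p * entry g j i' (p + diag ε) =
      (barcodeGen k B i (p + diag ε + diag ε) i' : k) := by
  have h := congrArg (fun φ => φ.hom (barcodeGen k B i p)) (hfg p)
  have h1 : (g.app (p + diag ε)).hom (genImage f i p) =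
    ((barcodeModule k B).map (homOfLE ((le_add_diag p ε).trans (le_add_diag (p + diag ε) ε)))).hom
      (barcodeGen k B i p) := h
  rw [barcodeModule_map_gen _ hp] at h1
  let c : (⨁ i, intervalFiber k (B i) (p + diag ε + diag ε)) →ₗ[k] k :=
    (intervalFiber k (B i') (p + diag ε + diag ε)).subtype ∘ₗ DirectSum.component k ι _ i'
  have h2 := linearMap_apply_eq_finsum (c ∘ₗ (g.app (p + diag ε)).hom) (genImage f i p)
  refine Eq.trans h2.symm ?_
  exact congrArg c h1

theorem barcodeGen_self {i : ι} {p : Plane} (h : p ∈ (B i).carrier) :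
    (barcodeGen k B i p i : k) = 1 := by
  classical
  rw [barcodeGen, DirectSum.lof_apply, intervalGen_coe_of_mem h]

theorem barcodeGen_of_ne {i i' : ι} (hne : i ≠ i') (p : Plane) :
    (barcodeGen k B i p i' : k) = 0 := by
  classical
  rw [barcodeGen, DirectSum.lof_eq_of, DirectSum.of_eq_of_ne _ _ _ hne.symm]
  rfl

open Classical in
/-- The matrix entry of a morphism at the points where it has to be constant. -/
def coef (i : ι) (j : κ) : k :=
  if h : ∃ p, p ∈ (B i).carrier ∧ p + diag ε ∈ (C j).carrier then entry f i j h.choose else 0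

variable {a b : ι → WithTop ℝ} {a' b' : κ → WithTop ℝ}

/-- A triangle is closed under joins, so both entries equal the one at the join of `p` and `q`,
whether or not this join lies in `B i`. -/
theorem entry_eq_entry (hC : ∀ j, HasCorner (C j) (a' j) (b' j)) {i : ι} {j : κ} {p q : Plane}
    (hp : p ∈ (B i).carrier) (hp' : p + diag ε ∈ (C j).carrier)
    (hq : q ∈ (B i).carrier) (hq' : q + diag ε ∈ (C j).carrier) :
    entry f i j p = entry f i j q := by
  have hr : Plane.mk (max p.x q.x) (max p.y q.y) + diag ε ∈ (C j).carrier := by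
    obtain ⟨h1, h2, h3⟩ := (hC j _).1 hp'
    obtain ⟨h4, h5, h6⟩ := (hC j _).1 hq'
    refine (hC j _).2 ⟨?_, ?_, ?_⟩
    · rcases max_choice p.x q.x with h | h
      · exact lt_of_eq_of_lt (congrArg (fun t : ℝ => ((t + ε : ℝ) : WithTop ℝ)) h) h1
      · exact lt_of_eq_of_lt (congrArg (fun t : ℝ => ((t + ε : ℝ) : WithTop ℝ)) h) h4
    · rcases max_choice p.y q.y with h | h
      · exact lt_of_eq_of_lt (congrArg (fun t : ℝ => ((t + ε : ℝ) : WithTop ℝ)) h) h2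
      · exact lt_of_eq_of_lt (congrArg (fun t : ℝ => ((t + ε : ℝ) : WithTop ℝ)) h) h5
    · refine h3.trans ?_
      change (p.x + ε) + (p.y + ε) ≤ (max p.x q.x + ε) + (max p.y q.y + ε)
      gcongr
      · exact le_max_left _ _
      · exact le_max_left _ _
  rw [entry_eq_of_le f (q := Plane.mk (max p.x q.x) (max p.y q.y))
      ⟨le_max_left _ _, le_max_left _ _⟩ hp hr,
    entry_eq_of_le f (q := Plane.mk (max p.x q.x) (max p.y q.y))
      ⟨le_max_right _ _, le_max_right _ _⟩ hq hr]

theorem coef_eq_entry (hC : ∀ j, HasCorner (C j) (a' j) (b' j)) {i : ι} {j : κ} {p : Plane}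
    (hp : p ∈ (B i).carrier) (hp' : p + diag ε ∈ (C j).carrier) :
    coef f i j = entry f i j p := by
  have h : ∃ p, p ∈ (B i).carrier ∧ p + diag ε ∈ (C j).carrier := ⟨p, hp, hp'⟩
  rw [coef, dif_pos h]
  exact entry_eq_entry f hC h.choose_spec.1 h.choose_spec.2 hp hp'

theorem exists_of_coef_ne_zero {i : ι} {j : κ} (h : coef f i j ≠ 0) :
    ∃ p, p ∈ (B i).carrier ∧ p + diag ε ∈ (C j).carrier ∧ entry f i j p ≠ 0 := by
  by_cases h' : ∃ p, p ∈ (B i).carrier ∧ p + diag ε ∈ (C j).carrier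
  · rw [coef, dif_pos h'] at h
    exact ⟨_, h'.choose_spec.1, h'.choose_spec.2, h⟩
  · rw [coef, dif_neg h'] at h
    exact absurd rfl h

/-- A nonzero entry at `p` persists at every `q ≥ p` with `q + ε` in `C j`, so `q` must still be in
`B i`. Moving `q` right or up towards the edge of `C j` bounds each coordinate of its corner. -/
theorem corner_le_of_coef_ne_zero (hB : ∀ i, HasCorner (B i) (a i) (b i))
    (hC : ∀ j, HasCorner (C j) (a' j) (b' j)) {i : ι} {j : κ} (h : coef f i j ≠ 0) :
    a' j ≤ a i + ((ε : ℝ) : WithTop ℝ) ∧ b' j ≤ b i + ((ε : ℝ) : WithTop ℝ) := by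
  obtain ⟨p, hp, hp', hne⟩ := exists_of_coef_ne_zero f h
  obtain ⟨h1, h2, h3⟩ := (hC j _).1 hp'
  have key : ∀ q : Plane, p ≤ q → q + diag ε ∈ (C j).carrier → q ∈ (B i).carrier := by
    intro q hpq hq
    by_contra hqB
    exact hne ((entry_eq_of_le f hpq hp hq).trans (entry_of_notMem f hqB j))
  constructor
  · refine le_add_of_forall_lt fun x hx => ?_
    have hq : Plane.mk (max p.x x) p.y + diag ε ∈ (C j).carrier := by
      refine (hC j _).2 ⟨?_, h2, h3.trans ?_⟩
      · rcases max_choice p.x x with h | h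
        · exact lt_of_eq_of_lt (congrArg (fun t : ℝ => ((t + ε : ℝ) : WithTop ℝ)) h) h1
        · exact lt_of_eq_of_lt (congrArg (fun t : ℝ => ((t + ε : ℝ) : WithTop ℝ)) h) hx
      · change (p.x + ε) + (p.y + ε) ≤ (max p.x x + ε) + (p.y + ε)
        gcongr
        exact le_max_left _ _
    refine lt_of_le_of_lt (WithTop.coe_le_coe.2 (le_max_right p.x x))
      ((hB i _).1 (key (Plane.mk _ _) ⟨le_max_left _ _, le_rfl⟩ hq)).1
  · refine le_add_of_forall_lt fun y hy => ?_
    have hq : Plane.mk p.x (max p.y y) + diag ε ∈ (C j).carrier := by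
      refine (hC j _).2 ⟨h1, ?_, h3.trans ?_⟩
      · rcases max_choice p.y y with h | h
        · exact lt_of_eq_of_lt (congrArg (fun t : ℝ => ((t + ε : ℝ) : WithTop ℝ)) h) h2
        · exact lt_of_eq_of_lt (congrArg (fun t : ℝ => ((t + ε : ℝ) : WithTop ℝ)) h) hy
      · change (p.x + ε) + (p.y + ε) ≤ (p.x + ε) + (max p.y y + ε)
        gcongr
        exact le_max_left _ _
    refine lt_of_le_of_lt (WithTop.coe_le_coe.2 (le_max_right p.y y))
      ((hB i _).1 (key (Plane.mk p.x (max p.y y)) ⟨le_rfl, le_max_left _ _⟩ hq)).2.1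

/-- At one point only finitely many entries of a row are nonzero, but the scalars of the row are
read off at varying points. Points with rational coordinates suffice. -/
theorem countable_coef_ne_zero (hB : ∀ i, HasCorner (B i) (a i) (b i))
    (hC : ∀ j, HasCorner (C j) (a' j) (b' j)) (i : ι) : {j | coef f i j ≠ 0}.Countable := by
  refine (Set.countable_iUnion fun q : ℚ × ℚ =>
    (finite_entry_ne_zero f i (Plane.mk q.1 q.2)).countable).mono fun j hj => ?_
  obtain ⟨p, hp, hp', -⟩ := exists_of_coef_ne_zero f hj
  obtain ⟨h1, h2, h3⟩ := (hB i _).1 hp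
  obtain ⟨h4, h5, h6⟩ := (hC j _).1 hp'
  obtain ⟨x, hx, hx1, hx2⟩ := exists_rat_between h1 h4
  obtain ⟨y, hy, hy1, hy2⟩ := exists_rat_between h2 h5
  refine Set.mem_iUnion.2 ⟨(x, y), ?_⟩
  have hq : Plane.mk x y ∈ (B i).carrier := (hB i _).2 ⟨hx1, hy1, by
    change (0 : ℝ) ≤ x + y
    linarith⟩
  have hq' : Plane.mk x y + diag ε ∈ (C j).carrier := (hC j _).2 ⟨hx2, hy2, h6.trans (by
    change (p.x + ε) + (p.y + ε) ≤ ((x : ℝ) + ε) + (y + ε)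
    linarith)⟩
  show entry f i j _ ≠ 0
  rw [← coef_eq_entry f hC hq hq']
  exact hj

/-- The scalars could differ from the entries only if `p + ε` is not in `C j`. In that case the
entry of `f` is zero, and so is the scalar of `g`: otherwise the corner bound would place `p + ε` in
`C j`. -/
theorem coef_mul_coef_eq (g : barcodeModule k C ⟶ shift ε (barcodeModule k B))
    (hB : ∀ i, HasCorner (B i) (a i) (b i)) (hC : ∀ j, HasCorner (C j) (a' j) (b' j))
    {i i' : ι} {p : Plane} (hp : p ∈ (B i).carrier) (hp' : p + diag ε + diag ε ∈ (B i').carrier)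
    (j : κ) : coef f i j * coef g j i' = entry f i j p * entry g j i' (p + diag ε) := by
  by_cases hj : p + diag ε ∈ (C j).carrier
  · rw [coef_eq_entry f hC hp hj, coef_eq_entry g hB hj hp']
  · rw [entry_of_notMem_right f i hj, zero_mul]
    by_contra hne
    have h := corner_le_of_coef_ne_zero g hC hB (right_ne_zero_of_mul hne)
    obtain ⟨h1, h2, -⟩ := (hB i' _).1 hp'
    obtain ⟨-, -, h3⟩ := (hB i _).1 hp
    refine hj ((hC j _).2 ⟨lt_of_add_lt_of_le_add h1 h.1, lt_of_add_lt_of_le_add h2 h.2, ?_⟩)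
    change 0 ≤ (p.x + ε) + (p.y + ε)
    have := ε.2
    linarith

/-- The interleaving identity is evaluated at a point `p` where `B i'` survives. If `B i` misses
`p`, every product vanishes, since two nonzero scalars would put the corner of `B i` within `2ε`
below that of `B i'` and hence `p` in `B i`. -/
theorem finsum_coef_mul_coef (g : barcodeModule k C ⟶ shift ε (barcodeModule k B))
    (hfg : ∀ p : Plane, f.app p ≫ g.app (p + diag ε) = (barcodeModule k B).map
      (homOfLE ((le_add_diag p ε).trans (le_add_diag (p + diag ε) ε))))
    (hB : ∀ i, HasCorner (B i) (a i) (b i)) (hC : ∀ j, HasCorner (C j) (a' j) (b' j))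
    {i i' : ι} {p : Plane} (hp : p ∈ (B i').carrier)
    (hp' : p + diag ε + diag ε ∈ (B i').carrier) :
    ∑ᶠ j, coef f i j * coef g j i' = (barcodeGen k B i (p + diag ε + diag ε) i' : k) := by
  by_cases hpi : p ∈ (B i).carrier
  · rw [← finsum_entry_mul_entry f g hfg hpi i']
    exact finsum_congr (coef_mul_coef_eq f g hB hC hpi hp')
  · have hne : i ≠ i' := by
      rintro rfl
      exact hpi hp
    rw [barcodeGen_of_ne hne]
    refine finsum_eq_zero_of_forall_eq_zero fun j => ?_
    by_contra h
    have h1 := corner_le_of_coef_ne_zero f hB hC (left_ne_zero_of_mul h)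
    have h2 := corner_le_of_coef_ne_zero g hC hB (right_ne_zero_of_mul h)
    obtain ⟨-, -, h0⟩ := (hB i' _).1 hp
    obtain ⟨hx, hy, -⟩ := (hB i' _).1 hp'
    refine hpi ((hB i _).2 ⟨?_, ?_, h0⟩)
    · exact lt_of_add_lt_of_le_add (lt_of_add_lt_of_le_add hx h2.1) h1.1
    · exact lt_of_add_lt_of_le_add (lt_of_add_lt_of_le_add hy h2.2) h1.2

/-- The indices of the intervals that survive a shift by `2ε`. -/
def surviving (ε : ℝ≥0) (B : ι → Interval Plane) : Set ι :=
  {i | ∃ p, p ∈ (B i).carrier ∧ p + diag ε + diag ε ∈ (B i).carrier}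

/-- An interleaving injects the indices of the intervals that survive a shift by `2ε` into the
indices of the other barcode, along pairs of nearby triangles. -/
theorem exists_injective_of_interleaving {η : ℝ} (hη : 0 < η)
    (g : barcodeModule k C ⟶ shift ε (barcodeModule k B))
    (hfg : ∀ p : Plane, f.app p ≫ g.app (p + diag ε) = (barcodeModule k B).map
      (homOfLE ((le_add_diag p ε).trans (le_add_diag (p + diag ε) ε))))
    (hB : ∀ i, HasCorner (B i) (a i) (b i)) (hC : ∀ j, HasCorner (C j) (a' j) (b' j)) :
    ∃ m : surviving ε B → κ,
      Function.Injective m ∧ ∀ i : surviving ε B, Close (ε + 2 * η) (a i) (a' (m i)) ∧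
        Close (ε + 2 * η) (b i) (b' (m i)) := by
  refine exists_injective_of_coefficients hη (fun i : surviving ε B => a i)
    (fun i : surviving ε B => b i) a' b'
    (fun i j => coef f i j) (fun j i => coef g j i)
    (fun i j h => corner_le_of_coef_ne_zero f hB hC h)
    (fun j i h => corner_le_of_coef_ne_zero g hC hB h)
    (fun j => (countable_coef_ne_zero g hC hB j).preimage Subtype.val_injective) ?_ ?_
  · rintro ⟨i, p, hp, hp'⟩
    exact (finsum_coef_mul_coef f g hfg hB hC hp hp').trans (barcodeGen_self hp')
  · rintro ⟨i, hi⟩ ⟨i', p, hp, hp'⟩ hne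
    exact (finsum_coef_mul_coef f g hfg hB hC hp hp').trans
      (barcodeGen_of_ne (fun h => hne (Subtype.ext h)) _)

end Entries

/-! ### Equality of the two distances -/

section Isometry

variable {k : Type u} [Field k]

/-- The injections cover the intervals surviving a shift by `2ε`, whereas the matching is taken at a
larger parameter `δ`; convexity bridges the two. -/
theorem exists_add_diag_mem {ε δ : ℝ≥0} (h : ε ≤ δ) {I : Interval Plane}
    (hI : ¬ IsTrivial (2 * δ) (intervalModule k I)) :
    ∃ p, p ∈ I.carrier ∧ p + diag ε + diag ε ∈ I.carrier := by
  obtain ⟨p, hp, hp'⟩ := exists_mem_of_not_isTrivial hI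
  refine ⟨p, hp, I.convex hp hp' ((le_add_diag p ε).trans (le_add_diag _ ε)) ?_⟩
  rw [← add_diag_add_diag]
  have hd : diag ε ≤ diag δ := ⟨h, h⟩
  exact add_le_add (add_le_add le_rfl hd) hd

theorem Interleaved.matched {ε η : ℝ≥0} (hη : 0 < η) {M N : PersMod k Plane}
    (hM : TriangleDecomposable M) (hN : TriangleDecomposable N) (h : Interleaved ε M N) :
    Matched (ε + 2 * η) M N := by
  obtain ⟨ι, B, ⟨e⟩, hB⟩ := hM
  obtain ⟨κ, C, ⟨e'⟩, hC⟩ := hN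
  choose a b hB using fun i => (hB i).hasCorner
  choose a' b' hC using fun j => (hC j).hasCorner
  obtain ⟨f, g, hfg, hgf⟩ := h.of_iso e e'
  have hη' : (0 : ℝ) < η := hη
  obtain ⟨m, hm, hmc⟩ := exists_injective_of_interleaving f hη' g hfg hB hC
  obtain ⟨n, hn, hnc⟩ := exists_injective_of_interleaving g hη' f hgf hC hB
  obtain ⟨σ, hσ, hσl, hσr⟩ := exists_pequiv_of_injective
    (fun i j => Close (ε + 2 * η) (a i) (a' j) ∧ Close (ε + 2 * η) (b i) (b' j)) m n hm hn hmc
    (fun j => ⟨(hnc j).1.symm, (hnc j).2.symm⟩)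
  refine ⟨ι, κ, B, C, ⟨e⟩, ⟨e'⟩, σ, fun i hi => ?_, fun j hj => ?_, fun i j hij => ?_⟩
  · by_contra h
    exact hσl i (exists_add_diag_mem le_self_add h) hi
  · by_contra h
    exact hσr j (exists_add_diag_mem le_self_add h) hj
  · have hc := hσ i j hij
    have hcast : (ε + 2 * η : ℝ) = ((ε + 2 * η : ℝ≥0) : ℝ) := by push_cast; rfl
    rw [hcast] at hc
    exact interleaved_of_close (hB i) (hC j) hc.1 hc.2

theorem bottleneckDist_le_interleavingDist {M N : PersMod k Plane}
    (hM : TriangleDecomposable M) (hN : TriangleDecomposable N) :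
    bottleneckDist M N ≤ interleavingDist M N := by
  refine le_iInf₂ fun ε h => ?_
  refine ENNReal.le_of_forall_pos_le_add fun δ hδ _ => ?_
  -- Mesh `δ / 2` makes the grid loss `2 * η` exactly `δ`.
  have hη : 0 < δ / 2 := half_pos hδ
  have h2 : ε + 2 * (δ / 2) = ε + δ := by rw [mul_div_cancel₀ _ two_ne_zero]
  have := iInf₂_le (f := fun (ε : ℝ≥0) (_ : Matched ε M N) => (ε : ℝ≥0∞)) _
    (h.matched hη hM hN)
  rw [h2] at this
  exact_mod_cast this

theorem interleavingDist_le_bottleneckDist (M N : PersMod k Plane) :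
    interleavingDist M N ≤ bottleneckDist M N :=
  le_iInf₂ fun ε h =>
    iInf₂_le (f := fun (ε : ℝ≥0) (_ : Interleaved ε M N) => (ε : ℝ≥0∞)) ε h.interleaved

end Isometry

end Persistence

end

theorem corollary5p5 {k : Type*} [Field k] (M N : Persistence.PersMod k Persistence.Plane)
    (hM : Persistence.TriangleDecomposable M) (hN : Persistence.TriangleDecomposable N) :
    Persistence.bottleneckDist M N = Persistence.interleavingDist M N :=
  le_antisymm (Persistence.bottleneckDist_le_interleavingDist hM hN)
    (Persistence.interleavingDist_le_bottleneckDist M N)
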